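/- Let $\Sigma=(B,K,O,\mathrm{ar},\mathrm{car})$ be a $\lambda_c$-signature: $B$ is a set of base types, $K$ a set of effect-free constants, $O$ a set of algebraic operations, and $\mathrm{ar},\mathrm{car}:K\sqcup O\to\mathbf{GTyp}(B)$ assign arities and coarities. Types are $\rho,\tau::=b\mid 1\mid\rho\times\tau\mid 0\mid\rho+\tau\mid\rho\to\tau$ with $b\in B$; ground types ($\mathbf{GTyp}(B)$) are the types without $\to$, and $\mathbf{GTyp}^{\times}(B)$ is the set of types built from base types with $1$ and $\times$ only. Terms are those of the call-by-value computational $\lambda$-calculus, $$M,N::=x\mid c\,M\mid o_\rho\,M\mid()\mid(M,N)\mid\pi_iM\mid\delta(M)\mid\iota_iM\mid\delta(M,x_1{:}\rho_1.N_1,x_2{:}\rho_2.N_2)\mid\lambda x{:}\rho.M\mid M\,N ,$$ with the standard typing rules together with: $\Gamma\vdash c\,M:\mathrm{car}(c)$ if $\Gamma\vdash M:\mathrm{ar}(c)$, and $\Gamma\vdash o_\rho\,M:\rho$ if $\Gamma\vdash M:(\mathrm{ar}(o)\to\rho)\times\mathrm{car}(o)$. Let $\mathcal C$ be a bicartesian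 closed category (with currying $\Lambda$) and $T$ a strong monad on $\mathcal C$ with unit $\eta$, multiplication $\mu$ and strength $\mathrm{st}_{X,Y}:X\times TY\to T(X\times Y)$. For $D,E\in\mathcal C$, a $(D,E)$-ary algebraic operation for $T$ is a natural transformation $o_X:(D\Rightarrow TX)\to(E\Rightarrow TX)$ such that $$o_{X\times Y}\circ(D\Rightarrow\mathrm{st}_{X,Y})\circ\kappa^D=(E\Rightarrow\mathrm{st}_{X,Y})\circ\kappa^E\circ(X\times o_Y),\qquad o_X\circ(D\Rightarrow\mu_X)=(E\Rightarrow\mu_X)\circ o_{TX},$$ where $\kappa^D:X\times(D\Rightarrow TY)\to(D\Rightarrow X\times TY)$ is the canonical morphism. Its generic effect $E\to TD$ is the transpose of the composite of the name $1\to(D\Rightarrow TD)$ of $\eta_D$ with $o_D$; conversely, $e:E\to TD$ induces the operation $o_X=\Lambda(\mu_X\circ T\mathrm{ev}\circ\mathrm{st}\circ(\mathrm{id}\times e))$. A strong monad morphism $\phi:T_1\to T_2$ is a monad morphism that commutes with the strengths; it sends an algebraic operation for $T_1$ with generic effect $e$ to the algebraic operation for $T_2$ induced by $\phi_D\circ e$,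 and this map is denoted $\mathbf{Alg}(\phi,D,E)$. A $\lambda_c(\Sigma)$-structure $\mathcal A=(\mathcal C,T,A,a)$ consists of such $\mathcal C$ and $T$, an object $A b$ for each $b\in B$, a morphism $a(c):\mathcal A[\![\mathrm{ar}(c)]\!]\to\mathcal A[\![\mathrm{car}(c)]\!]$ for each $c\in K$, and an $(\mathcal A[\![\mathrm{ar}(o)]\!],\mathcal A[\![\mathrm{car}(o)]\!])$-ary algebraic operation $a(o)$ for $T$ for each $o\in O$. Here $\mathcal A[\![-]\!]$ interprets $b$ by $Ab$, the types $1,\times,0,+$ by the bicartesian structure, and $\rho\to\tau$ by $\mathcal A[\![\rho]\!]\Rightarrow T\mathcal A[\![\tau]\!]$; contexts are interpreted by products. A well-typed term $\Gamma\vdash M:\rho$ is interpreted by the standard call-by-value semantics (left-to-right for pairs and applications) as a morphism $\mathcal A[\![M]\!]:\mathcal A[\![\Gamma]\!]\to T\mathcal A[\![\rho]\!]$, with $\mathcal A[\![c\,M]\!]=T(a(c))\circ\mathcal A[\![M]\!]$ and $\mathcal A[\![o_\rho\,M]\!]=\mu\circ T(\Lambda^{-1}(a(o)_{\mathcal A[\![\rho]\!]}))\circ\mathcal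 A[\![M]\!]$. **Proposition.** Assume $\mathrm{car}(c)\in\mathbf{GTyp}^{\times}(B)$ for every $c\in K$. Let $\phi:T_1\to T_2$ be a strong monad morphism between strong monads on $\mathcal C$, let $\mathcal A=(\mathcal C,T_1,A,a)$ be a $\lambda_c(\Sigma)$-structure, and let $\phi\mathcal A=(\mathcal C,T_2,A,\phi(a))$ be the structure with $\phi(a)(c)=a(c)$ for $c\in K$ and $\phi(a)(o)=\mathbf{Alg}(\phi,\mathcal A[\![\mathrm{ar}(o)]\!],\mathcal A[\![\mathrm{car}(o)]\!])(a(o))$ for $o\in O$ (ground types have the same interpretation in $\mathcal A$ and in $\phi\mathcal A$). Then for every well-typed term $x_1:\rho_1,\dots,x_n:\rho_n\vdash M:\rho$ in which $\rho_1,\dots,\rho_n,\rho$ are ground types, $$\phi_{\mathcal A[\![\rho]\!]}\circ\mathcal A[\![x_1:\rho_1,\dots,x_n:\rho_n\vdash M:\rho]\!]=(\phi\mathcal A)[\![x_1:\rho_1,\dots,x_n:\rho_n\vdash M:\rho]\!].$$ -/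

import Mathlib

open CategoryTheory MonoidalCategory CartesianMonoidalCategory Limits

/-! Strong monads, algebraic operations and generic effects on a bicartesian closed category,
and the computational lambda calculus with its interpretation.

A bicartesian closed category is a category `C` with `CartesianMonoidalCategory C`
(terminal object `𝟙_ C`, binary products `X ⊗ Y`), `MonoidalClosed C` (exponentials
`Y ⟶[C] Z`), `HasInitial C` and `HasBinaryCoproducts C`. -/

universe u v w

namespace LambdaC

noncomputable section

section Categorical

variable {C : Type u} [Category.{v} C] [CartesianMonoidalCategory C]

/-- The symmetry `X × Y ⟶ Y × X` of the cartesian product. -/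
def swap (X Y : C) : X ⊗ Y ⟶ Y ⊗ X := lift (snd X Y) (fst X Y)

theorem swap_swap (X Y : C) : swap X Y ≫ swap Y X = 𝟙 (X ⊗ Y) := by
  ext <;> simp [swap]

theorem swap_whiskerRight {X X' : C} (Y : C) (h : X ⟶ X') :
    swap Y X ≫ h ▷ Y = Y ◁ h ≫ swap Y X' := by
  ext <;> simp [swap]

section Closed

variable [MonoidalClosed C]

/-- Currying `C(X × Y, Z) → C(X, Y ⇒ Z)` in the second variable. -/
def cur {X Y Z : C} (f : X ⊗ Y ⟶ Z) : X ⟶ (Y ⟶[C] Z) :=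
  MonoidalClosed.curry (swap Y X ≫ f)

/-- Uncurrying, the inverse of `cur`. -/
def unc {X Y Z : C} (g : X ⟶ (Y ⟶[C] Z)) : X ⊗ Y ⟶ Z :=
  swap X Y ≫ MonoidalClosed.uncurry g

/-- Evaluation `(Y ⇒ Z) × Y ⟶ Z`. -/
def ev (Y Z : C) : (Y ⟶[C] Z) ⊗ Y ⟶ Z := unc (𝟙 (Y ⟶[C] Z))

/-- The canonical morphism `X × (D ⇒ Z) ⟶ D ⇒ (X × Z)`. -/
def pushIn (D X Z : C) : X ⊗ (D ⟶[C] Z) ⟶ (D ⟶[C] (X ⊗ Z)) :=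
  cur ((α_ X (D ⟶[C] Z) D).hom ≫ X ◁ ev D Z)

end Closed

variable (C) in
/-- A strong monad: a monad with a natural transformation `X × T Y ⟶ T (X × Y)` compatible with
the unit, the multiplication, the left unitor and the associator. -/
structure StrongMonad extends Monad C where
  /-- the strength -/
  str (X Y : C) : X ⊗ toMonad.obj Y ⟶ toMonad.obj (X ⊗ Y)
  str_natural {X X' Y Y' : C} (f : X ⟶ X') (g : Y ⟶ Y') :
    (f ⊗ₘ toMonad.map g) ≫ str X' Y' = str X Y ≫ toMonad.map (f ⊗ₘ g)
  str_unit (X Y : C) : X ◁ toMonad.η.app Y ≫ str X Y = toMonad.η.app (X ⊗ Y)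
  str_mult (X Y : C) :
    X ◁ toMonad.μ.app Y ≫ str X Y =
      str X (toMonad.obj Y) ≫ toMonad.map (str X Y) ≫ toMonad.μ.app (X ⊗ Y)
  str_leftUnitor (Y : C) :
    str (𝟙_ C) Y ≫ toMonad.map (λ_ Y).hom = (λ_ (toMonad.obj Y)).hom
  str_associator (X Y Z : C) :
    str (X ⊗ Y) Z ≫ toMonad.map (α_ X Y Z).hom =
      (α_ X Y (toMonad.obj Z)).hom ≫ X ◁ str Y Z ≫ str X (Y ⊗ Z)

/-- A strong monad morphism: a monad morphism that commutes with the strengths. -/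
structure StrongMonadHom (S T : StrongMonad C) extends MonadHom S.toMonad T.toMonad where
  app_str (X Y : C) : S.str X Y ≫ app (X ⊗ Y) = X ◁ app Y ≫ T.str X Y

theorem StrongMonad.str_whiskerRight (T : StrongMonad C) {X X' : C} (f : X ⟶ X') (Y : C) :
    f ▷ T.obj Y ≫ T.str X' Y = T.str X Y ≫ T.map (f ▷ Y) := by
  simpa [MonoidalCategory.tensorHom_def] using T.str_natural f (𝟙 Y)

theorem StrongMonad.str_whiskerLeft (T : StrongMonad C) (X : C) {Y Y' : C} (g : Y ⟶ Y') :
    X ◁ T.map g ≫ T.str X Y' = T.str X Y ≫ T.map (X ◁ g) := by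
  simpa [MonoidalCategory.tensorHom_def] using T.str_natural (𝟙 X) g

variable [MonoidalClosed C]

/-- A `(D, E)`-ary algebraic operation for `T`: a natural transformation
`(D ⇒ T X) ⟶ (E ⇒ T X)` compatible with the strength and the multiplication. -/
structure AlgOp (T : StrongMonad C) (D E : C) where
  /-- the components -/
  app (X : C) : (D ⟶[C] T.obj X) ⟶ (E ⟶[C] T.obj X)
  natural {X Y : C} (f : X ⟶ Y) :
    (ihom D).map (T.map f) ≫ app Y = app X ≫ (ihom E).map (T.map f)
  app_str (X Y : C) :
    pushIn D X (T.obj Y) ≫ (ihom D).map (T.str X Y) ≫ app (X ⊗ Y) =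
      X ◁ app Y ≫ pushIn E X (T.obj Y) ≫ (ihom E).map (T.str X Y)
  app_mult (X : C) :
    (ihom D).map (T.μ.app X) ≫ app X = app (T.obj X) ≫ (ihom E).map (T.μ.app X)

section Lemmas

theorem unc_cur {X Y Z : C} (f : X ⊗ Y ⟶ Z) : unc (cur f) = f := by
  rw [unc, cur, MonoidalClosed.uncurry_curry, ← Category.assoc, swap_swap, Category.id_comp]

theorem cur_unc {X Y Z : C} (g : X ⟶ (Y ⟶[C] Z)) : cur (unc g) = g := by
  rw [unc, cur, ← Category.assoc, swap_swap, Category.id_comp, MonoidalClosed.curry_uncurry]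

theorem comp_cur {X X' Y Z : C} (h : X' ⟶ X) (f : X ⊗ Y ⟶ Z) :
    h ≫ cur f = cur (h ▷ Y ≫ f) := by
  rw [cur, cur, ← MonoidalClosed.curry_natural_left, ← Category.assoc, ← Category.assoc,
    swap_whiskerRight]

theorem cur_ihom_map {X Y Z Z' : C} (f : X ⊗ Y ⟶ Z) (g : Z ⟶ Z') :
    cur f ≫ (ihom Y).map g = cur (f ≫ g) := by
  rw [cur, cur, ← MonoidalClosed.curry_natural_right, Category.assoc]

theorem whiskerRight_ev {X Y Z : C} (g : X ⟶ (Y ⟶[C] Z)) : g ▷ Y ≫ ev Y Z = unc g := by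
  have h : cur (g ▷ Y ≫ ev Y Z) = cur (unc g) := by
    rw [← comp_cur, ev, cur_unc, Category.comp_id, cur_unc]
  rw [← unc_cur (g ▷ Y ≫ ev Y Z), h, unc_cur]

theorem cur_ev {X Y Z : C} (f : X ⊗ Y ⟶ Z) : cur f ▷ Y ≫ ev Y Z = f := by
  rw [whiskerRight_ev, unc_cur]

theorem ihom_map_ev {Y Z Z' : C} (f : Z ⟶ Z') :
    (ihom Y).map f ▷ Y ≫ ev Y Z' = ev Y Z ≫ f := by
  have h : (ihom Y).map f = cur (ev Y Z ≫ f) := by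
    rw [← cur_ihom_map, ev, cur_unc, Category.id_comp]
  rw [h, cur_ev]

end Lemmas

/-- The transpose of a component of the algebraic operation of a generic effect. -/
def effectBind (T : StrongMonad C) {D E : C} (e : E ⟶ T.obj D) (X : C) :
    (D ⟶[C] T.obj X) ⊗ E ⟶ T.obj X :=
  (D ⟶[C] T.obj X) ◁ e ≫ T.str (D ⟶[C] T.obj X) D ≫ T.map (ev D (T.obj X)) ≫ T.μ.app X

/-- The generic effect `E ⟶ T D` of an algebraic operation: the transpose of
`1 ⟶ (D ⇒ T D) ⟶ (E ⇒ T D)`, where the first morphism is the name of the unit. -/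
def AlgOp.genericEffect {T : StrongMonad C} {D E : C} (o : AlgOp T D E) : E ⟶ T.obj D :=
  (λ_ E).inv ≫ unc (cur ((λ_ D).hom ≫ T.η.app D) ≫ o.app D)

theorem whiskerRight_effectBind (T : StrongMonad C) {D E : C} (e : E ⟶ T.obj D) {X Z : C}
    (h : Z ⟶ (D ⟶[C] T.obj X)) :
    h ▷ E ≫ effectBind T e X =
      Z ◁ e ≫ T.str Z D ≫ T.map (h ▷ D ≫ ev D (T.obj X)) ≫ T.μ.app X := by
  rw [effectBind, ← whisker_exchange_assoc, ← Category.assoc (h ▷ _), T.str_whiskerRight]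
  simp

/-- The algebraic operation of a generic effect `E ⟶ T D`. -/
def AlgOp.ofGenericEffect (T : StrongMonad C) {D E : C} (e : E ⟶ T.obj D) : AlgOp T D E where
  app X := cur (effectBind T e X)
  natural {X Y} f := by
    rw [comp_cur, cur_ihom_map, whiskerRight_effectBind, ihom_map_ev, effectBind]
    simp [T.mu_naturality]
  app_str X Y := by
    have h := T.str_associator X (D ⟶[C] T.obj Y) D
    rw [pushIn, pushIn, ← Category.assoc (cur _), cur_ihom_map, cur_ihom_map, comp_cur, comp_cur,
      whiskerRight_effectBind, cur_ev]
    congr 1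
    simp only [Functor.map_comp, Category.assoc]
    rw [reassoc_of% h, associator_naturality_middle_assoc, ← whiskerLeft_comp_assoc, cur_ev,
      effectBind]
    simp only [whiskerLeft_comp, Category.assoc, T.str_mult]
    rw [← Category.assoc (X ◁ T.map _), T.str_whiskerLeft]
    simp
  app_mult X := by
    rw [comp_cur, cur_ihom_map, whiskerRight_effectBind, ihom_map_ev, effectBind]
    simp [T.assoc]

/-- The action `Alg(S, D, E) → Alg(T, D, E)` of a strong monad morphism `S ⟶ T`:
compose the generic effect with the morphism. -/
def AlgOp.map {S T : StrongMonad C} (φ : StrongMonadHom S T) {D E : C} (o : AlgOp S D E) :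
    AlgOp T D E :=
  AlgOp.ofGenericEffect T (o.genericEffect ≫ φ.app D)

/-- Transport of an algebraic operation along equalities of its arity and coarity. -/
def AlgOp.cast {T : StrongMonad C} {D D' E E' : C} (hD : D = D') (hE : E = E')
    (o : AlgOp T D E) : AlgOp T D' E' :=
  hD ▸ hE ▸ o

end Categorical

section Calculus

/-- Types over a set `B` of base types. -/
inductive Ty (B : Type w) : Type w
  | base (b : B) : Ty B
  | unit : Ty B
  | prod (ρ τ : Ty B) : Ty B
  | empty : Ty B
  | sum (ρ τ : Ty B) : Ty B
  | arrow (ρ τ : Ty B) : Ty B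

/-- Ground types: types without function types. -/
def Ty.IsGround {B : Type w} : Ty B → Prop
  | .base _ => True
  | .unit => True
  | .prod ρ τ => ρ.IsGround ∧ τ.IsGround
  | .empty => True
  | .sum ρ τ => ρ.IsGround ∧ τ.IsGround
  | .arrow _ _ => False

/-- Types built from base types using only finite products. -/
def Ty.IsProductGround {B : Type w} : Ty B → Prop
  | .base _ => True
  | .unit => True
  | .prod ρ τ => ρ.IsProductGround ∧ τ.IsProductGround
  | .empty => False
  | .sum _ _ => False
  | .arrow _ _ => False

/-- A signature: base types, effect-free constants and algebraic operations, the latter two with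
ground arities and coarities. -/
structure Signature where
  /-- base types -/
  B : Type w
  /-- effect-free constants -/
  K : Type w
  /-- algebraic operations -/
  O : Type w
  /-- arities -/
  ar : K ⊕ O → {ρ : Ty B // ρ.IsGround}
  /-- coarities -/
  car : K ⊕ O → {ρ : Ty B // ρ.IsGround}

/-- Contexts `x₁ : ρ₁, …, xₙ : ρₙ`, as lists of types with the most recent variable `xₙ` first. -/
abbrev Ctx (B : Type w) := List (Ty B)

/-- `Var Γ ρ` is the type of variables of type `ρ` in the context `Γ`. -/
inductive Var {B : Type w} : Ctx B → Ty B → Type w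
  | last {Γ : Ctx B} {ρ : Ty B} : Var (ρ :: Γ) ρ
  | weaken {Γ : Ctx B} {ρ τ : Ty B} (x : Var Γ τ) : Var (ρ :: Γ) τ

/-- `Term S Γ ρ` is the type of (typing derivations of) well-typed terms `Γ ⊢ M : ρ`, with bound
variables represented by their position in the context. -/
inductive Term (S : Signature.{w}) : Ctx S.B → Ty S.B → Type w
  | var {Γ : Ctx S.B} {ρ : Ty S.B} (x : Var Γ ρ) : Term S Γ ρ
  | const {Γ : Ctx S.B} (c : S.K) (M : Term S Γ (S.ar (.inl c)).1) :
      Term S Γ (S.car (.inl c)).1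
  | op {Γ : Ctx S.B} (o : S.O) (ρ : Ty S.B)
      (M : Term S Γ (.prod (.arrow (S.ar (.inr o)).1 ρ) (S.car (.inr o)).1)) : Term S Γ ρ
  | unit {Γ : Ctx S.B} : Term S Γ .unit
  | pair {Γ : Ctx S.B} {ρ τ : Ty S.B} (M : Term S Γ ρ) (N : Term S Γ τ) : Term S Γ (.prod ρ τ)
  | fst {Γ : Ctx S.B} {ρ τ : Ty S.B} (M : Term S Γ (.prod ρ τ)) : Term S Γ ρ
  | snd {Γ : Ctx S.B} {ρ τ : Ty S.B} (M : Term S Γ (.prod ρ τ)) : Term S Γ τ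
  | absurd {Γ : Ctx S.B} {ρ : Ty S.B} (M : Term S Γ .empty) : Term S Γ ρ
  | inl {Γ : Ctx S.B} {ρ τ : Ty S.B} (M : Term S Γ ρ) : Term S Γ (.sum ρ τ)
  | inr {Γ : Ctx S.B} {ρ τ : Ty S.B} (M : Term S Γ τ) : Term S Γ (.sum ρ τ)
  | case {Γ : Ctx S.B} {ρ₁ ρ₂ τ : Ty S.B} (M : Term S Γ (.sum ρ₁ ρ₂))
      (N₁ : Term S (ρ₁ :: Γ) τ) (N₂ : Term S (ρ₂ :: Γ) τ) : Term S Γ τ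
  | lam {Γ : Ctx S.B} {ρ τ : Ty S.B} (M : Term S (ρ :: Γ) τ) : Term S Γ (.arrow ρ τ)
  | app {Γ : Ctx S.B} {ρ τ : Ty S.B} (M : Term S Γ (.arrow ρ τ)) (N : Term S Γ ρ) : Term S Γ τ

end Calculus

section Semantics

variable {C : Type u} [Category.{v} C] [CartesianMonoidalCategory C] [MonoidalClosed C]
  [HasInitial C] [HasBinaryCoproducts C]

/-- The interpretation of types for a strong monad `T` and an interpretation `A` of base types;
function types are interpreted by Kleisli exponentials. -/
def interpTy (T : StrongMonad C) {B : Type w} (A : B → C) : Ty B → C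
  | .base b => A b
  | .unit => 𝟙_ C
  | .prod ρ τ => interpTy T A ρ ⊗ interpTy T A τ
  | .empty => ⊥_ C
  | .sum ρ τ => interpTy T A ρ ⨿ interpTy T A τ
  | .arrow ρ τ => interpTy T A ρ ⟶[C] T.obj (interpTy T A τ)

/-- The interpretation of contexts. -/
def interpCtx (T : StrongMonad C) {B : Type w} (A : B → C) : Ctx B → C
  | [] => 𝟙_ C
  | ρ :: Γ => interpCtx T A Γ ⊗ interpTy T A ρ

variable (C) in
/-- A structure for a signature on the bicartesian closed category `C`, with strong monad `T`. -/
structure LambdaStructure (S : Signature.{w}) (T : StrongMonad C) where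
  /-- interpretation of base types -/
  A : S.B → C
  /-- interpretation of effect-free constants -/
  const (c : S.K) : interpTy T A (S.ar (.inl c)).1 ⟶ interpTy T A (S.car (.inl c)).1
  /-- interpretation of algebraic operations -/
  op (o : S.O) : AlgOp T (interpTy T A (S.ar (.inr o)).1) (interpTy T A (S.car (.inr o)).1)

/-- The pairing `X ⟶ T (Y × Z)` of `f : X ⟶ T Y` and `g : X ⟶ T Z` that runs `f` before `g`. -/
def kleisliPair (T : StrongMonad C) {X Y Z : C} (f : X ⟶ T.obj Y) (g : X ⟶ T.obj Z) :
    X ⟶ T.obj (Y ⊗ Z) :=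
  lift f g ≫ swap (T.obj Y) (T.obj Z) ≫ T.str (T.obj Z) Y ≫ T.map (swap (T.obj Z) Y) ≫
    T.map (T.str Y Z) ≫ T.μ.app (Y ⊗ Z)

namespace LambdaStructure

variable {S : Signature.{w}} {T : StrongMonad C}

/-- The interpretation of types in a structure. -/
abbrev ty (𝒜 : LambdaStructure C S T) (ρ : Ty S.B) : C := interpTy T 𝒜.A ρ

/-- The interpretation of contexts in a structure. -/
abbrev ctx (𝒜 : LambdaStructure C S T) (Γ : Ctx S.B) : C := interpCtx T 𝒜.A Γ

/-- Variables are interpreted by projections. -/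
def var (𝒜 : LambdaStructure C S T) : {Γ : Ctx S.B} → {ρ : Ty S.B} → Var Γ ρ → (𝒜.ctx Γ ⟶ 𝒜.ty ρ)
  | _, _, .last => CartesianMonoidalCategory.snd _ _
  | _, _, .weaken x => CartesianMonoidalCategory.fst _ _ ≫ 𝒜.var x

/-- The interpretation of well-typed terms. The morphism `(leftDistrib Γ X Y).inv` is
the inverse of `[Γ × ι₁, Γ × ι₂] : (Γ × X) + (Γ × Y) ⟶ Γ × (X + Y)`. -/
def tm (𝒜 : LambdaStructure C S T) :
    {Γ : Ctx S.B} → {ρ : Ty S.B} → Term S Γ ρ → (𝒜.ctx Γ ⟶ T.obj (𝒜.ty ρ))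
  | _, _, .var x => 𝒜.var x ≫ T.η.app _
  | _, _, .const c M => 𝒜.tm M ≫ T.map (𝒜.const c)
  | _, _, .op o ρ M => 𝒜.tm M ≫ T.map (unc ((𝒜.op o).app (𝒜.ty ρ))) ≫ T.μ.app (𝒜.ty ρ)
  | _, _, .unit => toUnit _ ≫ T.η.app (𝟙_ C)
  | _, _, .pair M N => kleisliPair T (𝒜.tm M) (𝒜.tm N)
  | _, _, .fst M => 𝒜.tm M ≫ T.map (CartesianMonoidalCategory.fst _ _)
  | _, _, .snd M => 𝒜.tm M ≫ T.map (CartesianMonoidalCategory.snd _ _)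
  | _, _, .absurd M => 𝒜.tm M ≫ T.map (initial.to _)
  | _, _, .inl M => 𝒜.tm M ≫ T.map coprod.inl
  | _, _, .inr M => 𝒜.tm M ≫ T.map coprod.inr
  | _, _, .case M N₁ N₂ =>
      lift (𝟙 _) (𝒜.tm M) ≫ T.str _ _ ≫ T.map (leftDistrib _ _ _).inv ≫
        T.map (coprod.desc (𝒜.tm N₁) (𝒜.tm N₂)) ≫ T.μ.app _
  | _, _, .lam M => cur (𝒜.tm M) ≫ T.η.app _
  | _, _, .app M N => kleisliPair T (𝒜.tm M) (𝒜.tm N) ≫ T.map (ev _ _) ≫ T.μ.app _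

end LambdaStructure

/-- The interpretation of a ground type does not depend on the strong monad. -/
theorem interpTy_eq_of_isGround (T₁ T₂ : StrongMonad C) {B : Type w} (A : B → C) :
    {ρ : Ty B} → ρ.IsGround → interpTy T₁ A ρ = interpTy T₂ A ρ
  | .base _, _ => rfl
  | .unit, _ => rfl
  | .prod _ _, h => congrArg₂ (fun X Y : C => X ⊗ Y) (interpTy_eq_of_isGround T₁ T₂ A h.1)
      (interpTy_eq_of_isGround T₁ T₂ A h.2)
  | .empty, _ => rfl
  | .sum _ _, h => congrArg₂ (fun X Y : C => X ⨿ Y) (interpTy_eq_of_isGround T₁ T₂ A h.1)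
      (interpTy_eq_of_isGround T₁ T₂ A h.2)

/-- The interpretation of a context of ground types does not depend on the strong monad. -/
theorem interpCtx_eq_of_isGround (T₁ T₂ : StrongMonad C) {B : Type w} (A : B → C) :
    {Γ : Ctx B} → (∀ ρ ∈ Γ, ρ.IsGround) → interpCtx T₁ A Γ = interpCtx T₂ A Γ
  | [], _ => rfl
  | _ :: _, h => congrArg₂ (fun X Y : C => X ⊗ Y)
      (interpCtx_eq_of_isGround T₁ T₂ A fun ρ hρ => h ρ (List.mem_cons_of_mem _ hρ))
      (interpTy_eq_of_isGround T₁ T₂ A (h _ List.mem_cons_self))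

/-- The structure `φ 𝒜` obtained from `𝒜` along a strong monad morphism `φ`. The equalities only
identify the interpretations of ground types for the two monads. -/
def LambdaStructure.map {S : Signature.{w}} {T₁ T₂ : StrongMonad C} (φ : StrongMonadHom T₁ T₂)
    (𝒜 : LambdaStructure C S T₁) : LambdaStructure C S T₂ where
  A := 𝒜.A
  const c :=
    eqToHom (interpTy_eq_of_isGround T₂ T₁ 𝒜.A (S.ar (.inl c)).2) ≫ 𝒜.const c ≫
      eqToHom (interpTy_eq_of_isGround T₁ T₂ 𝒜.A (S.car (.inl c)).2)
  op o :=
    ((𝒜.op o).map φ).cast (interpTy_eq_of_isGround T₁ T₂ 𝒜.A (S.ar (.inr o)).2)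
      (interpTy_eq_of_isGround T₁ T₂ 𝒜.A (S.car (.inr o)).2)

end Semantics

end

end LambdaC

/-! The proof is a logical relation argument with ⊤⊤-lifting. To each type is attached a relation
between generalized elements, at every stage `X`, of its two interpretations: equality at base
types, componentwise at products, preservation of relatedness at function types. At sums, related
elements must factor through the same injection, and at `0` nothing is related. Computations are
related (`topTop`) if, for any continuations that `φ` identifies on related values, running the
computations into them gives results identified by `φ`. By the fundamental lemma `tm_related`, every
term sends related environments to related computations.

At ground types related elements are equal (`comp_eqToHom_of_tyRel`), but equal elements need not be
related: a generalized element of a sum need not factor through an injection. Two facts deal with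
this gap. Constants must return related values, so their coarities are restricted to products of
base types, where equality does imply relatedness (`tyRel_of_comp_eqToHom`). For operations and for
the final statement it is enough that related pairs are jointly epic (`tyRel_jointlyEpic`,
`ctxRel_jointlyEpic`): two morphisms agreeing on related elements agree everywhere.

An operation is its generic effect followed by its argument as continuation (`AlgOp.app_eq`). Since
`φ` maps one generic effect to the other, only the continuations need to be compared, and joint
epicness does that (`topTop_bind_genericEffect`). At the end, taking the units as continuations in
`topTop` recovers the equation between the two interpretations (`topTop_app`). -/

namespace LambdaC

noncomputable section

/-! ### Parametrized Kleisli extension and its monad laws. -/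

section Bind

variable {C : Type u} [Category.{v} C] [CartesianMonoidalCategory C]

/-- Kleisli extension with a parameter: run `m`, then `k` on the parameter and the result. -/
def bind (T : StrongMonad C) {X A B : C} (m : X ⟶ T.obj A) (k : X ⊗ A ⟶ T.obj B) : X ⟶ T.obj B :=
  lift (𝟙 X) m ≫ T.str X A ≫ T.map k ≫ T.μ.app B

theorem comp_bind (T : StrongMonad C) {X Y A B : C} (y : Y ⟶ X) (m : X ⟶ T.obj A)
    (k : X ⊗ A ⟶ T.obj B) : y ≫ bind T m k = bind T (y ≫ m) (y ▷ A ≫ k) := by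
  have h : lift (𝟙 Y) (y ≫ m) ≫ y ▷ T.obj A = y ≫ lift (𝟙 X) m := by ext <;> simp
  rw [bind, bind, ← reassoc_of% h, ← Category.assoc (y ▷ _), T.str_whiskerRight]
  simp

theorem bind_unit (T : StrongMonad C) {X A B : C} (a : X ⟶ A) (k : X ⊗ A ⟶ T.obj B) :
    bind T (a ≫ T.η.app A) k = lift (𝟙 X) a ≫ k := by
  have h : lift (𝟙 X) (a ≫ T.η.app A) = lift (𝟙 X) a ≫ X ◁ T.η.app A := by ext <;> simp
  have h' : T.η.app (X ⊗ A) ≫ T.map k = k ≫ T.η.app (T.obj B) := (T.η.naturality k).symm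
  rw [bind, h, Category.assoc, ← Category.assoc (X ◁ _), T.str_unit, reassoc_of% h']
  simp

/-- Naturality along `X ⟶ 𝟙_ C` reduces this to the unitor axiom of the strength. -/
theorem str_map_snd (T : StrongMonad C) (X A : C) :
    T.str X A ≫ T.map (snd X A) = snd X (T.obj A) := by
  have h := T.str_whiskerRight (toUnit X) A
  have e : snd X A = toUnit X ▷ A ≫ (λ_ A).hom := by
    rw [leftUnitor_hom, whiskerRight_snd]
  rw [e, T.map_comp, ← Category.assoc, ← h, Category.assoc, T.str_leftUnitor, leftUnitor_hom,
    whiskerRight_snd]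

theorem bind_snd (T : StrongMonad C) {X A B : C} (m : X ⟶ T.obj A) (k : A ⟶ T.obj B) :
    bind T m (snd X A ≫ k) = m ≫ T.map k ≫ T.μ.app B := by
  rw [bind, T.map_comp, Category.assoc, ← Category.assoc (T.str _ _), str_map_snd]
  simp

theorem bind_snd_unit (T : StrongMonad C) {X A B : C} (m : X ⟶ T.obj A) (f : A ⟶ B) :
    bind T m (snd X A ≫ f ≫ T.η.app B) = m ≫ T.map f := by
  rw [bind_snd]
  simp

/-- The parameter is consumed by both `k` and `l`, so it is duplicated along the diagonal of `X`;
the associator axiom then fuses the two strengths into a single one for `X ⊗ X`, through which the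
diagonal slides by naturality. -/
theorem bind_assoc (T : StrongMonad C) {X A B D : C} (m : X ⟶ T.obj A) (k : X ⊗ A ⟶ T.obj B)
    (l : X ⊗ B ⟶ T.obj D) :
    bind T (bind T m k) l = bind T m (bind T k (fst X A ▷ B ≫ l)) := by
  have e : lift (𝟙 X) (bind T m k) = lift (𝟙 X) (lift (𝟙 X) m ≫ T.str X A ≫ T.map k) ≫
      X ◁ T.μ.app B := by ext <;> simp [bind]
  have hc : X ◁ T.str X A ≫ T.str X (X ⊗ A) =
      (α_ X X (T.obj A)).inv ≫ T.str (X ⊗ X) A ≫ T.map (α_ X X A).hom := by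
    rw [T.str_associator]; simp
  have e2 : lift (𝟙 X) (lift (𝟙 X) m ≫ T.str X A ≫ T.map k) =
      lift (𝟙 X) m ≫ lift (𝟙 X) (𝟙 X) ▷ T.obj A ≫ (α_ X X (T.obj A)).hom ≫
        X ◁ T.str X A ≫ X ◁ T.map k := by
    ext <;> simp
  have e3 : lift (𝟙 X) (𝟙 X) ▷ A ≫ (α_ X X A).hom ≫ X ◁ k =
      lift (𝟙 (X ⊗ A)) k ≫ fst X A ▷ T.obj B := by
    have h : lift (𝟙 X) (𝟙 X) ▷ A ≫ (α_ X X A).hom ≫ snd X (X ⊗ A) = 𝟙 (X ⊗ A) := by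
      ext <;> simp
    ext
    · simp
    · simp [reassoc_of% h]
  have hs := T.str_whiskerRight (fst X A) B
  have hd := T.str_whiskerRight (lift (𝟙 X) (𝟙 X)) A
  have hn : T.μ.app (X ⊗ B) ≫ T.map l = T.map (T.map l) ≫ T.μ.app (T.obj D) :=
    (T.μ.naturality l).symm
  have hk := T.str_whiskerLeft X k
  calc bind T (bind T m k) l
      = lift (𝟙 X) m ≫ (lift (𝟙 X) (𝟙 X) ▷ T.obj A ≫ T.str (X ⊗ X) A) ≫
          T.map (α_ X X A).hom ≫ T.map (X ◁ k) ≫ T.map (T.str X B) ≫ T.map (T.map l) ≫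
            T.μ.app _ ≫ T.μ.app _ := by
        rw [bind, e, Category.assoc, ← Category.assoc (X ◁ _), T.str_mult, e2]
        simp only [Category.assoc]
        rw [reassoc_of% hk, reassoc_of% hc, reassoc_of% hn]
        simp
    _ = lift (𝟙 X) m ≫ T.str X A ≫ T.map (lift (𝟙 X) (𝟙 X) ▷ A ≫ (α_ X X A).hom ≫ X ◁ k) ≫
          T.map (T.str X B) ≫ T.map (T.map l) ≫ T.map (T.μ.app _) ≫ T.μ.app _ := by
        rw [hd, T.assoc]
        simp
    _ = _ := by
        rw [e3, bind, bind]
        simp only [T.map_comp, Category.assoc]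
        simp only [← T.map_comp_assoc, reassoc_of% hs]

theorem StrongMonadHom.bind_app {S T : StrongMonad C} (φ : StrongMonadHom S T) {X A B : C}
    (m : X ⟶ S.obj A) (k : X ⊗ A ⟶ S.obj B) :
    bind S m k ≫ φ.app B = bind T (m ≫ φ.app A) (k ≫ φ.app B) := by
  have h : lift (𝟙 X) (m ≫ φ.app A) = lift (𝟙 X) m ≫ X ◁ φ.app A := by ext <;> simp
  have h' := φ.app_str X A
  rw [bind, bind, h, Category.assoc (lift (𝟙 X) m) (X ◁ _), ← Category.assoc (X ◁ _), ← h']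
  simp only [Category.assoc, φ.app_μ, T.map_comp]
  rw [φ.naturality_assoc, φ.naturality_assoc]

/-- Allows pairs and applications to be treated by the laws of `bind` alone. -/
theorem kleisliPair_eq_bind (T : StrongMonad C) {X Y Z : C} (f : X ⟶ T.obj Y) (g : X ⟶ T.obj Z) :
    kleisliPair T f g =
      bind T f (bind T (fst X Y ≫ g) (snd X Y ▷ Z ≫ T.η.app (Y ⊗ Z))) := by
  have hg : bind T (fst X Y ≫ g) (snd X Y ▷ Z ≫ T.η.app (Y ⊗ Z)) =
      g ▷ Y ≫ swap (T.obj Z) Y ≫ T.str Y Z := by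
    have h : lift (𝟙 (X ⊗ Y)) (fst X Y ≫ g) ≫ snd X Y ▷ T.obj Z =
        g ▷ Y ≫ swap (T.obj Z) Y := by ext <;> simp [swap]
    have hs := T.str_whiskerRight (snd X Y) Z
    rw [← reassoc_of% h, hs, bind]
    simp
  have h : lift f g ≫ swap (T.obj Y) (T.obj Z) = lift (𝟙 X) f ≫ g ▷ T.obj Y := by
    ext <;> simp [swap]
  have hs := T.str_whiskerRight g Y
  rw [hg, kleisliPair, reassoc_of% h, reassoc_of% hs, bind]
  simp

/-! ### Algebraic operations in terms of their generic effects. -/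

section Closed

variable [MonoidalClosed C]

theorem lift_unc {X Y Z P : C} (a : P ⟶ X) (b : P ⟶ Y) (g : X ⟶ (Y ⟶[C] Z)) :
    lift a b ≫ unc g = lift (a ≫ g) b ≫ ev Y Z := by
  rw [← whiskerRight_ev, ← Category.assoc]
  congr 1
  ext <;> simp

theorem comp_unc {X X' Y Z : C} (h : X' ⟶ X) (g : X ⟶ (Y ⟶[C] Z)) :
    unc (h ≫ g) = h ▷ Y ≫ unc g := by
  rw [← whiskerRight_ev, ← whiskerRight_ev, comp_whiskerRight, Category.assoc]

theorem lift_pushIn {P D X Z : C} (x : P ⟶ X) (a : P ⟶ (D ⟶[C] Z)) :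
    lift x a ≫ pushIn D X Z = cur (lift (fst P D ≫ x) (unc a)) := by
  rw [pushIn, comp_cur, ← whiskerRight_ev]
  congr 1
  ext
  · simp
  · simp only [Category.assoc, lift_snd, whiskerLeft_snd]
    rw [← Category.assoc, ← Category.assoc]
    congr 1
    ext <;> simp

/-- An algebraic operation is determined by its generic effect. -/
theorem AlgOp.app_eq (T : StrongMonad C) {D E : C} (o : AlgOp T D E) {P X : C}
    (h : P ⟶ (D ⟶[C] T.obj X)) :
    h ≫ o.app X = cur (bind T (snd P E ≫ o.genericEffect) (fst P E ▷ D ≫ unc h)) := by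
  -- By `h₁` and `h₂`, `h` is the name `n` of the unit, pushed under the parameter `P` and then
  -- extended along `unc h`. The axioms of an algebraic operation move `o` through both steps, so
  -- that it acts on `n` only.
  let n : 𝟙_ C ⟶ (D ⟶[C] T.obj D) := cur ((λ_ D).hom ≫ T.η.app D)
  have h₁ : lift (𝟙 P) (toUnit P ≫ n) ≫ pushIn D P (T.obj D) ≫ (ihom D).map (T.str P D) =
      cur (T.η.app (P ⊗ D)) := by
    have e : lift (fst P D ≫ 𝟙 P) (unc (toUnit P ≫ n)) = P ◁ T.η.app D := by
      rw [comp_unc, unc_cur, leftUnitor_hom, whiskerRight_snd_assoc]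
      ext <;> simp
    rw [← Category.assoc, lift_pushIn, cur_ihom_map, e, T.str_unit]
  have h₂ : cur (T.η.app (P ⊗ D)) ≫ (ihom D).map (T.map (unc h)) ≫ (ihom D).map (T.μ.app X) =
      h := by
    have e : T.η.app (P ⊗ D) ≫ T.map (unc h) = unc h ≫ T.η.app (T.obj X) :=
      (T.η.naturality (unc h)).symm
    rw [← Functor.map_comp, cur_ihom_map, reassoc_of% e]
    simp [cur_unc]
  have h₃ : toUnit P ▷ E ≫ unc (n ≫ o.app D) = snd P E ≫ o.genericEffect := by
    rw [AlgOp.genericEffect, ← Category.assoc (snd P E)]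
    congr 1
    ext
    simp
  have h₄ : lift (fst P E ≫ 𝟙 P) (snd P E ≫ o.genericEffect) =
      lift (𝟙 (P ⊗ E)) (snd P E ≫ o.genericEffect) ≫ fst P E ▷ T.obj D := by
    ext <;> simp
  have hs := T.str_whiskerRight (fst P E) D
  calc h ≫ o.app X
      = cur (T.η.app (P ⊗ D)) ≫ o.app (P ⊗ D) ≫ (ihom E).map (T.map (unc h) ≫ T.μ.app X) := by
        conv_lhs => rw [← h₂]
        simp only [Category.assoc, o.app_mult, Functor.map_comp]
        rw [reassoc_of% o.natural (unc h)]
    _ = lift (𝟙 P) (toUnit P ≫ n ≫ o.app D) ≫ pushIn E P (T.obj D) ≫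
          (ihom E).map (T.str P D ≫ T.map (unc h) ≫ T.μ.app X) := by
        have e : lift (𝟙 P) (toUnit P ≫ n ≫ o.app D) =
            lift (𝟙 P) (toUnit P ≫ n) ≫ P ◁ o.app D := by ext <;> simp
        rw [← h₁, e]
        simp only [Category.assoc, Functor.map_comp]
        rw [reassoc_of% o.app_str P D]
    _ = _ := by
        rw [← Category.assoc, lift_pushIn, cur_ihom_map, comp_unc, h₃, h₄, bind]
        simp only [Category.assoc, T.map_comp]
        rw [reassoc_of% hs]

theorem lift_unc_app (T : StrongMonad C) {D E : C} (o : AlgOp T D E) {P X : C}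
    (h : P ⟶ (D ⟶[C] T.obj X)) (e : P ⟶ E) :
    lift h e ≫ unc (o.app X) = bind T (e ≫ o.genericEffect) (unc h) := by
  have h₁ : lift h e = lift (𝟙 P) e ≫ h ▷ E := by ext <;> simp
  have h₂ : lift (𝟙 P) e ▷ D ≫ fst P E ▷ D = 𝟙 (P ⊗ D) := by
    rw [← comp_whiskerRight]; simp
  rw [h₁, Category.assoc, ← comp_unc, o.app_eq, unc_cur, comp_bind, ← Category.assoc,
    reassoc_of% h₂]
  simp

theorem lift_unc_ofGenericEffect_app (T : StrongMonad C) {D E : C} (g : E ⟶ T.obj D) {P X : C}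
    (h : P ⟶ (D ⟶[C] T.obj X)) (e : P ⟶ E) :
    lift h e ≫ unc ((AlgOp.ofGenericEffect T g).app X) = bind T (e ≫ g) (unc h) := by
  have h₁ : lift h e = lift (𝟙 P) e ≫ h ▷ E := by ext <;> simp
  have h₂ : lift (𝟙 P) (e ≫ g) = lift (𝟙 P) e ≫ P ◁ g := by ext <;> simp
  rw [h₁, Category.assoc, AlgOp.ofGenericEffect, unc_cur, whiskerRight_effectBind,
    whiskerRight_ev, bind, h₂, Category.assoc]

theorem lift_unc_cast_ofGenericEffect_app (T : StrongMonad C) {D D' E E' : C} (hD : D = D')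
    (hE : E = E') (g : E ⟶ T.obj D) {P X : C} (h : P ⟶ (D' ⟶[C] T.obj X)) (e : P ⟶ E') :
    lift h e ≫ unc (((AlgOp.ofGenericEffect T g).cast hD hE).app X) =
      bind T (e ≫ eqToHom hE.symm ≫ g) (P ◁ eqToHom hD ≫ unc h) := by
  subst hD hE
  simpa [AlgOp.cast] using lift_unc_ofGenericEffect_app T g h e

end Closed

end Bind

/-! ### Relations on generalized elements, joint epicness and ⊤⊤-lifting. -/

section KripkeRelation

variable {C : Type u} [Category.{v} C]

/-- A family of relations between generalized elements of `A` and of `B`. -/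
abbrev KripkeRel (A B : C) := ∀ X : C, (X ⟶ A) → (X ⟶ B) → Prop

namespace KripkeRel

/-- Stability under reindexing. -/
def Monotone {A B : C} (R : KripkeRel A B) : Prop :=
  ∀ ⦃X Y : C⦄ (y : Y ⟶ X) ⦃a : X ⟶ A⦄ ⦃b : X ⟶ B⦄, R X a b → R Y (y ≫ a) (y ≫ b)

/-- The sum of two relations: related elements factor through the same injection. -/
def sum [HasBinaryCoproducts C] {A B A' B' : C} (R : KripkeRel A B) (R' : KripkeRel A' B') :
    KripkeRel (A ⨿ A') (B ⨿ B') :=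
  fun X a b => (∃ a' b', R X a' b' ∧ a = a' ≫ coprod.inl ∧ b = b' ≫ coprod.inl) ∨
    ∃ a' b', R' X a' b' ∧ a = a' ≫ coprod.inr ∧ b = b' ≫ coprod.inr

theorem Monotone.sum [HasBinaryCoproducts C] {A B A' B' : C} {R : KripkeRel A B}
    {R' : KripkeRel A' B'} (h : R.Monotone) (h' : R'.Monotone) : (R.sum R').Monotone := by
  rintro X Y y a b (⟨a', b', hab, rfl, rfl⟩ | ⟨a', b', hab, rfl, rfl⟩)
  · exact .inl ⟨_, _, h y hab, by simp, by simp⟩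
  · exact .inr ⟨_, _, h' y hab, by simp, by simp⟩

variable [CartesianMonoidalCategory C]

/-- The product of two relations. -/
def prod {A B A' B' : C} (R : KripkeRel A B) (R' : KripkeRel A' B') :
    KripkeRel (A ⊗ A') (B ⊗ B') :=
  fun X a b => R X (a ≫ fst A A') (b ≫ fst B B') ∧ R' X (a ≫ snd A A') (b ≫ snd B B')

/-- The `⊤⊤`-lifting of a relation along a strong monad morphism: computations are related if the
morphism identifies their extensions along all continuations that it identifies on related
elements. -/
def topTop {T₁ T₂ : StrongMonad C} (φ : StrongMonadHom T₁ T₂) {A B : C} (R : KripkeRel A B) :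
    KripkeRel (T₁.obj A) (T₂.obj B) :=
  fun X m₁ m₂ => ∀ (Y : C) (y : Y ⟶ X) (Z : C) (k₁ : Y ⊗ A ⟶ T₁.obj Z) (k₂ : Y ⊗ B ⟶ T₂.obj Z),
    (∀ (Y' : C) (y' : Y' ⟶ Y) (a : Y' ⟶ A) (b : Y' ⟶ B), R Y' a b →
      lift y' a ≫ k₁ ≫ φ.app Z = lift y' b ≫ k₂) →
    bind T₁ (y ≫ m₁) k₁ ≫ φ.app Z = bind T₂ (y ≫ m₂) k₂

/-- The exponential of two relations. -/
def exp [MonoidalClosed C] {A B A' B' : C} (R : KripkeRel A B) (R' : KripkeRel A' B') :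
    KripkeRel (A ⟶[C] A') (B ⟶[C] B') :=
  fun X f g => ∀ (Y : C) (y : Y ⟶ X) (a : Y ⟶ A) (b : Y ⟶ B), R Y a b →
    R' Y (lift (y ≫ f) a ≫ ev A A') (lift (y ≫ g) b ≫ ev B B')

/-- The left components of related pairs are jointly epic, also in the presence of a parameter. -/
def JointlyEpic {A B : C} (R : KripkeRel A B) : Prop :=
  ∀ (W Z : C) (s t : W ⊗ A ⟶ Z),
    (∀ (Y : C) (y : Y ⟶ W) (a : Y ⟶ A) (b : Y ⟶ B), R Y a b → lift y a ≫ s = lift y a ≫ t) → s = t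

theorem Monotone.prod {A B A' B' : C} {R : KripkeRel A B} {R' : KripkeRel A' B'}
    (h : R.Monotone) (h' : R'.Monotone) : (R.prod R').Monotone := by
  rintro X Y y a b ⟨h₁, h₂⟩
  constructor
  · simpa only [Category.assoc] using h y h₁
  · simpa only [Category.assoc] using h' y h₂

theorem Monotone.exp [MonoidalClosed C] {A B A' B' : C} (R : KripkeRel A B)
    (R' : KripkeRel A' B') : (R.exp R').Monotone := by
  intro X Y y f g h Y' y' a b hab
  simpa only [Category.assoc] using h Y' (y' ≫ y) a b hab

/-- One factor is handled at a time, the other being absorbed into the parameter. Monotonicity of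
`R'` is needed because its related pair is reindexed while the first factor varies. -/
theorem JointlyEpic.prod {A B A' B' : C} {R : KripkeRel A B} {R' : KripkeRel A' B'}
    (hR : R.JointlyEpic) (hR' : R'.JointlyEpic) (hm : R'.Monotone) :
    (R.prod R').JointlyEpic := by
  intro W Z s t h
  -- Here `a` is already arbitrary; only the second component still has to belong to a related pair.
  have h₁ : ∀ (Y : C) (y : Y ⟶ W) (a : Y ⟶ A) (a' : Y ⟶ A') (b' : Y ⟶ B'), R' Y a' b' →
      lift y (lift a a') ≫ s = lift y (lift a a') ≫ t := by
    intro Y y a a' b' hab'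
    have h₂ := hR Y Z (lift (fst Y A ≫ y) (lift (snd Y A) (fst Y A ≫ a')) ≫ s)
      (lift (fst Y A ≫ y) (lift (snd Y A) (fst Y A ≫ a')) ≫ t) (by
        intro Y' y' c d hcd
        have h₃ := h Y' (y' ≫ y) (lift c (y' ≫ a')) (lift d (y' ≫ b'))
          ⟨by simpa using hcd, by simpa using hm y' hab'⟩
        simpa [comp_lift_assoc] using h₃)
    have h₄ := congrArg (fun x => lift (𝟙 Y) a ≫ x) h₂
    simpa [comp_lift_assoc] using h₄
  have h₅ := hR' (W ⊗ A) Z ((α_ W A A').hom ≫ s) ((α_ W A A').hom ≫ t) (by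
    intro Y y a' b' hab'
    have h₆ := h₁ Y (y ≫ fst W A) (y ≫ snd W A) a' b' hab'
    have e : lift y a' ≫ (α_ W A A').hom = lift (y ≫ fst W A) (lift (y ≫ snd W A) a') := by
      ext <;> simp
    rw [reassoc_of% e, reassoc_of% e, h₆])
  exact (cancel_epi _).1 h₅

/-- Products distribute over coproducts by closedness, so a morphism out of `W ⊗ (A ⨿ A')` is
determined on the two summands, and there the related pairs of each summand suffice. -/
theorem JointlyEpic.sum [MonoidalClosed C] [HasBinaryCoproducts C] {A B A' B' : C}
    {R : KripkeRel A B} {R' : KripkeRel A' B'} (hR : R.JointlyEpic) (hR' : R'.JointlyEpic) :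
    (R.sum R').JointlyEpic := by
  intro W Z s t h
  rw [← cancel_epi (leftDistrib W A A').hom]
  ext
  · rw [coprod_inl_leftDistrib_hom_assoc, coprod_inl_leftDistrib_hom_assoc]
    refine hR W Z _ _ fun Y y a b hab => ?_
    have := h Y y (a ≫ coprod.inl) (b ≫ coprod.inl) (.inl ⟨a, b, hab, rfl, rfl⟩)
    simpa using this
  · rw [coprod_inr_leftDistrib_hom_assoc, coprod_inr_leftDistrib_hom_assoc]
    refine hR' W Z _ _ fun Y y a b hab => ?_
    have := h Y y (a ≫ coprod.inr) (b ≫ coprod.inr) (.inr ⟨a, b, hab, rfl, rfl⟩)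
    simpa using this

theorem jointlyEpic_of_forall {A : C} {R : KripkeRel A A}
    (h : ∀ (X : C) (a : X ⟶ A), R X a a) : R.JointlyEpic := by
  intro W Z s t hst
  simpa using hst (W ⊗ A) (fst W A) (snd W A) _ (h _ _)

/-- Currying turns `s` and `t` into morphisms out of an initial object, so even the empty relation
is jointly epic. -/
theorem jointlyEpic_of_isInitial [MonoidalClosed C] {A B : C} (R : KripkeRel A B)
    (hA : IsInitial A) : R.JointlyEpic := by
  intro W Z s t _
  apply MonoidalClosed.curry_injective
  exact hA.hom_ext _ _

/-! ### Closure of ⊤⊤-liftings under the monad operations. -/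

variable {T₁ T₂ : StrongMonad C} (φ : StrongMonadHom T₁ T₂)

theorem topTop_monotone {A B : C} (R : KripkeRel A B) : (R.topTop φ).Monotone := by
  intro X Y y m₁ m₂ h Y' y' Z k₁ k₂ hk
  simpa only [Category.assoc] using h Y' (y' ≫ y) Z k₁ k₂ hk

variable {φ}

theorem topTop_unit {A B : C} {R : KripkeRel A B} (hR : R.Monotone) {X : C} {a : X ⟶ A}
    {b : X ⟶ B} (h : R X a b) : R.topTop φ X (a ≫ T₁.η.app A) (b ≫ T₂.η.app B) := by
  intro Y y Z k₁ k₂ hk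
  rw [← Category.assoc, ← Category.assoc, bind_unit, bind_unit, Category.assoc]
  exact hk Y (𝟙 Y) _ _ (hR y h)

/-- By associativity, testing the composite computation against `l` is testing `m` against "`k`,
then `l`"; `hk` says that these are admissible test continuations. -/
theorem topTop_bind {A B A' B' : C} {R : KripkeRel A B} {R' : KripkeRel A' B'} {X : C}
    {m₁ : X ⟶ T₁.obj A} {m₂ : X ⟶ T₂.obj B} (hm : R.topTop φ X m₁ m₂)
    {k₁ : X ⊗ A ⟶ T₁.obj A'} {k₂ : X ⊗ B ⟶ T₂.obj B'}
    (hk : ∀ (Y : C) (y : Y ⟶ X) (a : Y ⟶ A) (b : Y ⟶ B), R Y a b →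
      R'.topTop φ Y (lift y a ≫ k₁) (lift y b ≫ k₂)) :
    R'.topTop φ X (bind T₁ m₁ k₁) (bind T₂ m₂ k₂) := by
  intro Y y Z l₁ l₂ hl
  rw [comp_bind, comp_bind, bind_assoc, bind_assoc]
  refine hm Y y Z _ _ fun Y' y' a b hab => ?_
  have h := hk Y' (y' ≫ y) a b hab Y' (𝟙 Y') Z (y' ▷ A' ≫ l₁) (y' ▷ B' ≫ l₂)
    fun Y'' y'' a' b' hab' => by simpa using hl Y'' (y'' ≫ y') a' b' hab'
  rw [← Category.assoc (lift y' a), comp_bind, comp_bind, ← comp_whiskerRight_assoc,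
    ← comp_whiskerRight_assoc, lift_fst, lift_fst, lift_whiskerRight_assoc,
    lift_whiskerRight_assoc]
  simpa only [Category.id_comp] using h

theorem topTop_map {A B A' B' : C} {R : KripkeRel A B} {R' : KripkeRel A' B'}
    (hR' : R'.Monotone) {X : C} {m₁ : X ⟶ T₁.obj A} {m₂ : X ⟶ T₂.obj B}
    (hm : R.topTop φ X m₁ m₂) {f : A ⟶ A'} {g : B ⟶ B'}
    (h : ∀ (Y : C) (a : Y ⟶ A) (b : Y ⟶ B), R Y a b → R' Y (a ≫ f) (b ≫ g)) :
    R'.topTop φ X (m₁ ≫ T₁.map f) (m₂ ≫ T₂.map g) := by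
  rw [← bind_snd_unit, ← bind_snd_unit]
  refine topTop_bind hm fun Y y a b hab => ?_
  simpa using topTop_unit hR' (h Y a b hab)

theorem topTop_extend {A B A' B' : C} {R : KripkeRel A B} {R' : KripkeRel A' B'}
    {X : C} {m₁ : X ⟶ T₁.obj A} {m₂ : X ⟶ T₂.obj B} (hm : R.topTop φ X m₁ m₂)
    {f : A ⟶ T₁.obj A'} {g : B ⟶ T₂.obj B'}
    (h : ∀ (Y : C) (a : Y ⟶ A) (b : Y ⟶ B), R Y a b → R'.topTop φ Y (a ≫ f) (b ≫ g)) :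
    R'.topTop φ X (m₁ ≫ T₁.map f ≫ T₁.μ.app A') (m₂ ≫ T₂.map g ≫ T₂.μ.app B') := by
  rw [← bind_snd, ← bind_snd]
  refine topTop_bind hm fun Y y a b hab => ?_
  simpa using h Y a b hab

theorem topTop_kleisliPair {A B A' B' : C} {R : KripkeRel A B} {R' : KripkeRel A' B'}
    (hR : R.Monotone) (hR' : R'.Monotone) {X : C}
    {m₁ : X ⟶ T₁.obj A} {m₂ : X ⟶ T₂.obj B} (hm : R.topTop φ X m₁ m₂)
    {n₁ : X ⟶ T₁.obj A'} {n₂ : X ⟶ T₂.obj B'} (hn : R'.topTop φ X n₁ n₂) :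
    (R.prod R').topTop φ X (kleisliPair T₁ m₁ n₁) (kleisliPair T₂ m₂ n₂) := by
  rw [kleisliPair_eq_bind, kleisliPair_eq_bind]
  refine topTop_bind hm fun Y y a b hab => ?_
  rw [comp_bind, comp_bind]
  refine topTop_bind (R := R') ?_ fun Y' y' a' b' hab' => ?_
  · simpa using topTop_monotone φ R' y hn
  · have h := topTop_unit (φ := φ) (R := R.prod R') (hR.prod hR') (a := lift (y' ≫ a) a')
      (b := lift (y' ≫ b) b') ⟨by simpa using hR y' hab, by simpa using hab'⟩
    simpa using h

/-- Lifted computations of equal values are identified by the monad morphism. -/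
theorem topTop_app {A B : C} {R : KripkeRel A B} (j : B ⟶ A)
    (hR : ∀ (X : C) (a : X ⟶ A) (b : X ⟶ B), R X a b → a = b ≫ j) {X : C}
    {m₁ : X ⟶ T₁.obj A} {m₂ : X ⟶ T₂.obj B} (h : R.topTop φ X m₁ m₂) :
    m₁ ≫ φ.app A = m₂ ≫ T₂.map j := by
  -- The test continuations are the units, with `j` bringing both results to the common object `A`.
  have h := h X (𝟙 X) A (snd X A ≫ 𝟙 A ≫ T₁.η.app A) (snd X B ≫ j ≫ T₂.η.app A)
    fun Y y a b hab => by simp [hR Y a b hab]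
  rw [bind_snd_unit, bind_snd_unit] at h
  simpa using h

variable [MonoidalClosed C]

/-- The effects `e` and `e ≫ φ.app D` are not assumed to be related in the lifting of `R`. Instead,
`φ` is pushed through the first `bind`, which makes the effects on both sides equal up to `j`; the
continuations then agree because they agree on related pairs and `R` is jointly epic. -/
theorem topTop_bind_genericEffect {D D' A B : C} {R : KripkeRel D D'} {R' : KripkeRel A B}
    (hepi : R.JointlyEpic) (j : D ⟶ D')
    (hR : ∀ (X : C) (a : X ⟶ D) (b : X ⟶ D'), R X a b → a ≫ j = b) {X : C}
    {f : X ⟶ (D ⟶[C] T₁.obj A)} {g : X ⟶ (D' ⟶[C] T₂.obj B)}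
    (hfg : (R.exp (R'.topTop φ)) X f g) (e : X ⟶ T₁.obj D) :
    R'.topTop φ X (bind T₁ e (unc f)) (bind T₂ (e ≫ φ.app D) (X ◁ j ≫ unc g)) := by
  intro Y y Z l₁ l₂ hl
  rw [comp_bind, comp_bind, bind_assoc, bind_assoc, φ.bind_app, Category.assoc]
  congr 1
  refine hepi Y _ _ _ fun Y' y' a b hab => ?_
  have h := hfg Y' (y' ≫ y) a b hab Y' (𝟙 Y') Z (y' ▷ A ≫ l₁) (y' ▷ B ≫ l₂)
    fun Y'' y'' a' b' hab' => by simpa using hl Y'' (y'' ≫ y') a' b' hab'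
  rw [← Category.assoc (lift y' a), comp_bind, comp_bind, ← comp_whiskerRight_assoc,
    ← comp_whiskerRight_assoc, lift_fst, lift_whiskerRight_assoc,
    lift_whiskerRight_assoc, lift_whiskerLeft_assoc, hR Y' a b hab, lift_unc, lift_unc]
  simpa only [Category.id_comp] using h

/-- The coarity needs only that related elements are equal, the arity also joint epicness; both hold
at all ground types, so operations, unlike constants, may have sums in their coarities. -/
theorem topTop_op {D D' E E' A B : C} (o : AlgOp T₁ D E) (hD : D = D') (hE : E = E')
    {R : KripkeRel D D'} {Q : KripkeRel E E'} {R' : KripkeRel A B} (hepi : R.JointlyEpic)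
    (hR : ∀ (X : C) (a : X ⟶ D) (b : X ⟶ D'), R X a b → a ≫ eqToHom hD = b)
    (hQ : ∀ (X : C) (a : X ⟶ E) (b : X ⟶ E'), Q X a b → a ≫ eqToHom hE = b) {X : C}
    {a : X ⟶ (D ⟶[C] T₁.obj A) ⊗ E} {b : X ⟶ (D' ⟶[C] T₂.obj B) ⊗ E'}
    (h : ((R.exp (R'.topTop φ)).prod Q) X a b) :
    R'.topTop φ X (a ≫ unc (o.app A)) (b ≫ unc (((o.map φ).cast hD hE).app B)) := by
  have ha : a = lift (a ≫ fst _ _) (a ≫ snd _ _) := by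
    rw [← comp_lift, lift_fst_snd, Category.comp_id]
  have hb : b = lift (b ≫ fst _ _) (b ≫ snd _ _) := by
    rw [← comp_lift, lift_fst_snd, Category.comp_id]
  rw [ha, hb, lift_unc_app, AlgOp.map, lift_unc_cast_ofGenericEffect_app, ← hQ X _ _ h.2]
  have key := topTop_bind_genericEffect (φ := φ) hepi (eqToHom hD) hR h.1
    ((a ≫ snd _ _) ≫ o.genericEffect)
  simpa using key

-- This and the following variants carry the environments `γ₁`, `γ₂` in front, in the shape of the
-- clauses of `LambdaStructure.tm`.
omit [MonoidalClosed C] in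
theorem topTop_comp_map {A B A' B' G G' : C} {R : KripkeRel A B} {R' : KripkeRel A' B'}
    (hR' : R'.Monotone) {X : C} {γ₁ : X ⟶ G} {γ₂ : X ⟶ G'} {m₁ : G ⟶ T₁.obj A}
    {m₂ : G' ⟶ T₂.obj B} (hm : R.topTop φ X (γ₁ ≫ m₁) (γ₂ ≫ m₂)) {f : A ⟶ A'} {g : B ⟶ B'}
    (h : ∀ (Y : C) (a : Y ⟶ A) (b : Y ⟶ B), R Y a b → R' Y (a ≫ f) (b ≫ g)) :
    R'.topTop φ X (γ₁ ≫ m₁ ≫ T₁.map f) (γ₂ ≫ m₂ ≫ T₂.map g) := by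
  simpa using topTop_map hR' hm h

omit [MonoidalClosed C] in
theorem topTop_comp_extend {A B A' B' G G' : C} {R : KripkeRel A B} {R' : KripkeRel A' B'}
    {X : C} {γ₁ : X ⟶ G} {γ₂ : X ⟶ G'} {m₁ : G ⟶ T₁.obj A} {m₂ : G' ⟶ T₂.obj B}
    (hm : R.topTop φ X (γ₁ ≫ m₁) (γ₂ ≫ m₂)) {f : A ⟶ T₁.obj A'} {g : B ⟶ T₂.obj B'}
    (h : ∀ (Y : C) (a : Y ⟶ A) (b : Y ⟶ B), R Y a b → R'.topTop φ Y (a ≫ f) (b ≫ g)) :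
    R'.topTop φ X (γ₁ ≫ m₁ ≫ T₁.map f ≫ T₁.μ.app A') (γ₂ ≫ m₂ ≫ T₂.map g ≫ T₂.μ.app B') := by
  simpa only [Category.assoc] using topTop_extend hm h

omit [MonoidalClosed C] in
theorem topTop_comp_kleisliPair {A B A' B' G G' : C} {R : KripkeRel A B} {R' : KripkeRel A' B'}
    (hR : R.Monotone) (hR' : R'.Monotone) {X : C} {γ₁ : X ⟶ G} {γ₂ : X ⟶ G'}
    {m₁ : G ⟶ T₁.obj A} {m₂ : G' ⟶ T₂.obj B} (hm : R.topTop φ X (γ₁ ≫ m₁) (γ₂ ≫ m₂))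
    {n₁ : G ⟶ T₁.obj A'} {n₂ : G' ⟶ T₂.obj B'} (hn : R'.topTop φ X (γ₁ ≫ n₁) (γ₂ ≫ n₂)) :
    (R.prod R').topTop φ X (γ₁ ≫ kleisliPair T₁ m₁ n₁) (γ₂ ≫ kleisliPair T₂ m₂ n₂) := by
  simpa only [kleisliPair, comp_lift_assoc] using topTop_kleisliPair hR hR' hm hn

theorem topTop_ev {A B A' B' : C} {R : KripkeRel A B} {R' : KripkeRel (T₁.obj A') (T₂.obj B')}
    {X : C} {a : X ⟶ (A ⟶[C] T₁.obj A') ⊗ A} {b : X ⟶ (B ⟶[C] T₂.obj B') ⊗ B}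
    (h : ((R.exp R').prod R) X a b) : R' X (a ≫ ev _ _) (b ≫ ev _ _) := by
  simpa [← comp_lift] using h.1 X (𝟙 X) _ _ h.2

theorem exp_cur {A B A' B' G G' : C} {Q : KripkeRel G G'} {R : KripkeRel A B}
    {R' : KripkeRel A' B'} (hQ : Q.Monotone) {f : G ⊗ A ⟶ A'} {g : G' ⊗ B ⟶ B'}
    (h : ∀ (X : C) (x : X ⟶ G ⊗ A) (y : X ⟶ G' ⊗ B), Q.prod R X x y → R' X (x ≫ f) (y ≫ g))
    {X : C} {γ₁ : X ⟶ G} {γ₂ : X ⟶ G'} (hγ : Q X γ₁ γ₂) :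
    R.exp R' X (γ₁ ≫ cur f) (γ₂ ≫ cur g) := by
  intro Y y a b hab
  have e₁ := lift_unc (y ≫ γ₁) a (cur f)
  have e₂ := lift_unc (y ≫ γ₂) b (cur g)
  rw [unc_cur, Category.assoc] at e₁ e₂
  rw [← e₁, ← e₂]
  exact h Y _ _ ⟨by simpa using hQ y hγ, by simpa using hab⟩

/-- Related elements of a sum lie in the same summand, so both sides take the same branch after
distributing. This is why equality would be too weak as a relation at sums. -/
theorem topTop_comp_case [HasBinaryCoproducts C] {A₁ A₂ B₁ B₂ A B G G' : C} {Q : KripkeRel G G'}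
    {R₁ : KripkeRel A₁ B₁} {R₂ : KripkeRel A₂ B₂} {R : KripkeRel A B} (hQ : Q.Monotone)
    {X : C} {γ₁ : X ⟶ G} {γ₂ : X ⟶ G'} (hγ : Q X γ₁ γ₂) {m₁ : G ⟶ T₁.obj (A₁ ⨿ A₂)}
    {m₂ : G' ⟶ T₂.obj (B₁ ⨿ B₂)} (hm : (R₁.sum R₂).topTop φ X (γ₁ ≫ m₁) (γ₂ ≫ m₂))
    {f₁ : G ⊗ A₁ ⟶ T₁.obj A} {f₂ : G ⊗ A₂ ⟶ T₁.obj A}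
    {g₁ : G' ⊗ B₁ ⟶ T₂.obj B} {g₂ : G' ⊗ B₂ ⟶ T₂.obj B}
    (h₁ : ∀ (X : C) (x : X ⟶ G ⊗ A₁) (y : X ⟶ G' ⊗ B₁), Q.prod R₁ X x y →
      R.topTop φ X (x ≫ f₁) (y ≫ g₁))
    (h₂ : ∀ (X : C) (x : X ⟶ G ⊗ A₂) (y : X ⟶ G' ⊗ B₂), Q.prod R₂ X x y →
      R.topTop φ X (x ≫ f₂) (y ≫ g₂)) :
    R.topTop φ X
      (γ₁ ≫ lift (𝟙 G) m₁ ≫ T₁.str _ _ ≫ T₁.map (leftDistrib _ _ _).inv ≫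
        T₁.map (coprod.desc f₁ f₂) ≫ T₁.μ.app _)
      (γ₂ ≫ lift (𝟙 G') m₂ ≫ T₂.str _ _ ≫ T₂.map (leftDistrib _ _ _).inv ≫
        T₂.map (coprod.desc g₁ g₂) ≫ T₂.μ.app _) := by
  have key : R.topTop φ X
      (γ₁ ≫ bind T₁ m₁ ((leftDistrib G A₁ A₂).inv ≫ coprod.desc f₁ f₂))
      (γ₂ ≫ bind T₂ m₂ ((leftDistrib G' B₁ B₂).inv ≫ coprod.desc g₁ g₂)) := by
    rw [comp_bind, comp_bind]
    refine topTop_bind hm ?_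
    rintro Y y a b (⟨a', b', hab, rfl, rfl⟩ | ⟨a', b', hab, rfl, rfl⟩)
    · have h := h₁ Y (lift (y ≫ γ₁) a') (lift (y ≫ γ₂) b')
        ⟨by simpa using hQ y hγ, by simpa using hab⟩
      rw [lift_whiskerRight_assoc, lift_whiskerRight_assoc, ← lift_whiskerLeft_assoc,
        ← lift_whiskerLeft_assoc, whiskerLeft_coprod_inl_leftDistrib_inv_assoc,
        whiskerLeft_coprod_inl_leftDistrib_inv_assoc, coprod.inl_desc, coprod.inl_desc]
      exact h
    · have h := h₂ Y (lift (y ≫ γ₁) a') (lift (y ≫ γ₂) b')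
        ⟨by simpa using hQ y hγ, by simpa using hab⟩
      rw [lift_whiskerRight_assoc, lift_whiskerRight_assoc, ← lift_whiskerLeft_assoc,
        ← lift_whiskerLeft_assoc, whiskerLeft_coprod_inr_leftDistrib_inv_assoc,
        whiskerLeft_coprod_inr_leftDistrib_inv_assoc, coprod.inr_desc, coprod.inr_desc]
      exact h
  simpa [bind] using key

end KripkeRel

end KripkeRelation

/-! ### The logical relation and its comparison with equality at ground types. -/

section LogicalRelation

variable {C : Type u} [Category.{v} C] [CartesianMonoidalCategory C] [MonoidalClosed C]
  [HasInitial C] [HasBinaryCoproducts C] {T₁ T₂ : StrongMonad C} (φ : StrongMonadHom T₁ T₂)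
  {B : Type w} (A : B → C)

/-- The logical relation between the two interpretations of a type. -/
def tyRel : (ρ : Ty B) → KripkeRel (interpTy T₁ A ρ) (interpTy T₂ A ρ)
  | .base b => fun X (x y : X ⟶ A b) => x = y
  | .unit => fun _ _ _ => True
  | .prod ρ τ => (tyRel ρ).prod (tyRel τ)
  | .empty => fun _ _ _ => False
  | .sum ρ τ => (tyRel ρ).sum (tyRel τ)
  | .arrow ρ τ => (tyRel ρ).exp ((tyRel τ).topTop φ)

/-- The logical relation between the two interpretations of a context. -/
def ctxRel : (Γ : Ctx B) → KripkeRel (interpCtx T₁ A Γ) (interpCtx T₂ A Γ)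
  | [] => fun _ _ _ => True
  | ρ :: Γ => (ctxRel Γ).prod (tyRel φ A ρ)

theorem tyRel_monotone : (ρ : Ty B) → (tyRel φ A ρ).Monotone
  | .base _ => fun _ _ y _ _ h => congrArg (y ≫ ·) h
  | .unit => fun _ _ _ _ _ _ => trivial
  | .prod ρ τ => (tyRel_monotone ρ).prod (tyRel_monotone τ)
  | .empty => fun _ _ _ _ _ h => h.elim
  | .sum ρ τ => (tyRel_monotone ρ).sum (tyRel_monotone τ)
  | .arrow _ _ => KripkeRel.Monotone.exp _ _

theorem ctxRel_monotone : (Γ : Ctx B) → (ctxRel φ A Γ).Monotone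
  | [] => fun _ _ _ _ _ _ => trivial
  | ρ :: Γ => (ctxRel_monotone Γ).prod (tyRel_monotone φ A ρ)

theorem tyRel_jointlyEpic : {ρ : Ty B} → ρ.IsGround → (tyRel φ A ρ).JointlyEpic
  | .base _, _ => KripkeRel.jointlyEpic_of_forall fun _ _ => rfl
  | .unit, _ => KripkeRel.jointlyEpic_of_forall fun _ _ => trivial
  | .prod _ τ, h =>
      (tyRel_jointlyEpic h.1).prod (tyRel_jointlyEpic h.2) (tyRel_monotone φ A τ)
  | .empty, _ => KripkeRel.jointlyEpic_of_isInitial _ initialIsInitial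
  | .sum _ _, h => (tyRel_jointlyEpic h.1).sum (tyRel_jointlyEpic h.2)

theorem ctxRel_jointlyEpic : {Γ : Ctx B} → (∀ ρ ∈ Γ, ρ.IsGround) → (ctxRel φ A Γ).JointlyEpic
  | [], _ => KripkeRel.jointlyEpic_of_forall fun _ _ => trivial
  | ρ :: _, h => (ctxRel_jointlyEpic fun σ hσ => h σ (List.mem_cons_of_mem _ hσ)).prod
      (tyRel_jointlyEpic φ A (h _ List.mem_cons_self)) (tyRel_monotone φ A ρ)

-- With free objects in place of interpretations, the equalities can be eliminated by `subst`.
omit [MonoidalClosed C] [HasInitial C] [HasBinaryCoproducts C] in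
theorem comp_eqToHom_tensor {X Y Y' Z Z' : C} (h : Y = Y') (h' : Z = Z')
    (e : Y ⊗ Z = Y' ⊗ Z') {a : X ⟶ Y ⊗ Z} {b : X ⟶ Y' ⊗ Z'}
    (h₁ : (a ≫ fst Y Z) ≫ eqToHom h = b ≫ fst Y' Z')
    (h₂ : (a ≫ snd Y Z) ≫ eqToHom h' = b ≫ snd Y' Z') : a ≫ eqToHom e = b := by
  subst h h'
  ext
  · simpa using h₁
  · simpa using h₂

omit [CartesianMonoidalCategory C] [MonoidalClosed C] [HasInitial C] in
theorem comp_eqToHom_inl {X Y Y' Z Z' : C} (h : Y = Y') (h' : Z = Z')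
    (e : (Y ⨿ Z) = (Y' ⨿ Z')) {a : X ⟶ Y ⨿ Z} {b : X ⟶ Y' ⨿ Z'} {a' : X ⟶ Y} {b' : X ⟶ Y'}
    (hab : a' ≫ eqToHom h = b') (ha : a = a' ≫ coprod.inl) (hb : b = b' ≫ coprod.inl) :
    a ≫ eqToHom e = b := by
  subst h h' hab ha hb
  simp

omit [CartesianMonoidalCategory C] [MonoidalClosed C] [HasInitial C] in
theorem comp_eqToHom_inr {X Y Y' Z Z' : C} (h : Y = Y') (h' : Z = Z')
    (e : (Y ⨿ Z) = (Y' ⨿ Z')) {a : X ⟶ Y ⨿ Z} {b : X ⟶ Y' ⨿ Z'} {a' : X ⟶ Z} {b' : X ⟶ Z'}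
    (hab : a' ≫ eqToHom h' = b') (ha : a = a' ≫ coprod.inr) (hb : b = b' ≫ coprod.inr) :
    a ≫ eqToHom e = b := by
  subst h h' hab ha hb
  simp

/-- At ground types, related elements are equal. -/
theorem comp_eqToHom_of_tyRel : {ρ : Ty B} → (hρ : ρ.IsGround) → {X : C} →
    {a : X ⟶ interpTy T₁ A ρ} → {b : X ⟶ interpTy T₂ A ρ} → tyRel φ A ρ X a b →
    a ≫ eqToHom (interpTy_eq_of_isGround T₁ T₂ A hρ) = b
  | .base _, _, _, a, _, h => (Category.comp_id a).trans h
  | .unit, _, _, _, _, _ => toUnit_unique _ _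
  | .prod _ _, hρ, _, _, _, h =>
      comp_eqToHom_tensor _ _ _ (comp_eqToHom_of_tyRel hρ.1 h.1) (comp_eqToHom_of_tyRel hρ.2 h.2)
  | .empty, _, _, _, _, h => h.elim
  | .sum _ _, hρ, _, _, _, .inl ⟨_, _, h, ha, hb⟩ =>
      comp_eqToHom_inl _ (interpTy_eq_of_isGround T₁ T₂ A hρ.2) _
        (comp_eqToHom_of_tyRel hρ.1 h) ha hb
  | .sum _ _, hρ, _, _, _, .inr ⟨_, _, h, ha, hb⟩ =>
      comp_eqToHom_inr (interpTy_eq_of_isGround T₁ T₂ A hρ.1) _ _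
        (comp_eqToHom_of_tyRel hρ.2 h) ha hb

theorem comp_eqToHom_of_ctxRel : {Γ : Ctx B} → (hΓ : ∀ ρ ∈ Γ, ρ.IsGround) → {X : C} →
    {a : X ⟶ interpCtx T₁ A Γ} → {b : X ⟶ interpCtx T₂ A Γ} → ctxRel φ A Γ X a b →
    a ≫ eqToHom (interpCtx_eq_of_isGround T₁ T₂ A hΓ) = b
  | [], _, _, _, _, _ => toUnit_unique _ _
  | _ :: _, hΓ, _, _, _, h =>
      comp_eqToHom_tensor _ _ _
        (comp_eqToHom_of_ctxRel (fun σ hσ => hΓ σ (List.mem_cons_of_mem _ hσ)) h.1)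
        (comp_eqToHom_of_tyRel φ A (hΓ _ List.mem_cons_self) h.2)

/-- At types built from base types by finite products, equal elements are related. -/
theorem tyRel_of_comp_eqToHom : {ρ : Ty B} → ρ.IsProductGround → (hρ : ρ.IsGround) → {X : C} →
    {a : X ⟶ interpTy T₁ A ρ} → {b : X ⟶ interpTy T₂ A ρ} →
    a ≫ eqToHom (interpTy_eq_of_isGround T₁ T₂ A hρ) = b → tyRel φ A ρ X a b
  | .base _, _, _, _, a, _, h => (Category.comp_id a).symm.trans h
  | .unit, _, _, _, _, _, _ => trivial
  | .prod ρ τ, hp, hρ, X, a, b, h => by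
      have key : ∀ {Y Y' Z Z' : C} (e₁ : Y = Y') (e₂ : Z = Z') (e : Y ⊗ Z = Y' ⊗ Z')
          (a : X ⟶ Y ⊗ Z), (a ≫ fst Y Z) ≫ eqToHom e₁ = (a ≫ eqToHom e) ≫ fst Y' Z' ∧
            (a ≫ snd Y Z) ≫ eqToHom e₂ = (a ≫ eqToHom e) ≫ snd Y' Z' := by
        rintro Y _ Z _ rfl rfl e a
        simp
      subst h
      have h := key (interpTy_eq_of_isGround T₁ T₂ A hρ.1) (interpTy_eq_of_isGround T₁ T₂ A hρ.2)
        (interpTy_eq_of_isGround T₁ T₂ A hρ) a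
      exact ⟨tyRel_of_comp_eqToHom hp.1 hρ.1 h.1, tyRel_of_comp_eqToHom hp.2 hρ.2 h.2⟩

end LogicalRelation

/-! ### The fundamental lemma, by induction on terms. -/

section FundamentalLemma

variable {C : Type u} [Category.{v} C] [CartesianMonoidalCategory C] [MonoidalClosed C]
  [HasInitial C] [HasBinaryCoproducts C] {S : Signature.{w}} {T₁ T₂ : StrongMonad C}
  (φ : StrongMonadHom T₁ T₂) (𝒜 : LambdaStructure C S T₁)

theorem var_related : {Γ : Ctx S.B} → {ρ : Ty S.B} → (x : Var Γ ρ) → {X : C} →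
    {γ₁ : X ⟶ 𝒜.ctx Γ} → {γ₂ : X ⟶ (𝒜.map φ).ctx Γ} → ctxRel φ 𝒜.A Γ X γ₁ γ₂ →
    tyRel φ 𝒜.A ρ X (γ₁ ≫ 𝒜.var x) (γ₂ ≫ (𝒜.map φ).var x)
  | _, _, .last, _, _, _, h => h.2
  | _, ρ, .weaken x, X, _, _, h =>
      Eq.mp (congrArg₂ (tyRel φ 𝒜.A ρ X) (Category.assoc _ _ _) (Category.assoc _ _ _))
        (var_related x h.1)

/-- Related arguments are equal, hence so are the results; the restriction on coarities is what
makes equal results related. -/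
theorem const_related (hcar : ∀ c : S.K, (S.car (.inl c)).1.IsProductGround) (c : S.K) (X : C)
    (a : X ⟶ 𝒜.ty (S.ar (.inl c)).1) (b : X ⟶ (𝒜.map φ).ty (S.ar (.inl c)).1)
    (h : tyRel φ 𝒜.A _ X a b) :
    tyRel φ 𝒜.A _ X (a ≫ 𝒜.const c) (b ≫ (𝒜.map φ).const c) := by
  refine tyRel_of_comp_eqToHom φ 𝒜.A (hcar c) (S.car (.inl c)).2 ?_
  rw [← comp_eqToHom_of_tyRel φ 𝒜.A (S.ar (.inl c)).2 h]
  simp [LambdaStructure.map]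

theorem op_related (o : S.O) (ρ : Ty S.B) (X : C)
    (a : X ⟶ 𝒜.ty (.prod (.arrow (S.ar (.inr o)).1 ρ) (S.car (.inr o)).1))
    (b : X ⟶ (𝒜.map φ).ty (.prod (.arrow (S.ar (.inr o)).1 ρ) (S.car (.inr o)).1))
    (h : tyRel φ 𝒜.A _ X a b) :
    (tyRel φ 𝒜.A ρ).topTop φ X (a ≫ unc ((𝒜.op o).app (𝒜.ty ρ)))
      (b ≫ unc (((𝒜.map φ).op o).app ((𝒜.map φ).ty ρ))) :=
  KripkeRel.topTop_op (𝒜.op o) _ _ (tyRel_jointlyEpic φ 𝒜.A (S.ar (.inr o)).2)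
    (fun _ _ _ => comp_eqToHom_of_tyRel φ 𝒜.A (S.ar (.inr o)).2)
    (fun _ _ _ => comp_eqToHom_of_tyRel φ 𝒜.A (S.car (.inr o)).2) h

/-- The fundamental lemma of the logical relation. -/
theorem tm_related (hcar : ∀ c : S.K, (S.car (.inl c)).1.IsProductGround) :
    {Γ : Ctx S.B} → {ρ : Ty S.B} → (M : Term S Γ ρ) → (X : C) → (γ₁ : X ⟶ 𝒜.ctx Γ) →
    (γ₂ : X ⟶ (𝒜.map φ).ctx Γ) → ctxRel φ 𝒜.A Γ X γ₁ γ₂ →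
    (tyRel φ 𝒜.A ρ).topTop φ X (γ₁ ≫ 𝒜.tm M) (γ₂ ≫ (𝒜.map φ).tm M)
  | _, ρ, .var x, X, _, _, h =>
      Eq.mp (congrArg₂ ((tyRel φ 𝒜.A ρ).topTop φ X) (Category.assoc _ _ _) (Category.assoc _ _ _))
        (KripkeRel.topTop_unit (tyRel_monotone φ 𝒜.A ρ) (var_related φ 𝒜 x h))
  | _, _, .const c M, X, γ₁, γ₂, h =>
      KripkeRel.topTop_comp_map (tyRel_monotone φ 𝒜.A _) (tm_related hcar M X γ₁ γ₂ h)
        (const_related φ 𝒜 hcar c)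
  | _, _, .op o ρ M, X, γ₁, γ₂, h =>
      KripkeRel.topTop_comp_extend (tm_related hcar M X γ₁ γ₂ h) (op_related φ 𝒜 o ρ)
  | _, _, .unit, X, γ₁, γ₂, _ =>
      Eq.mp (congrArg₂ ((tyRel φ 𝒜.A .unit).topTop φ X) (Category.assoc _ _ _)
          (Category.assoc _ _ _))
        (KripkeRel.topTop_unit (tyRel_monotone φ 𝒜.A .unit)
          (a := γ₁ ≫ toUnit _) (b := γ₂ ≫ toUnit _) trivial)
  | _, _, .pair M N, X, γ₁, γ₂, h =>
      KripkeRel.topTop_comp_kleisliPair (tyRel_monotone φ 𝒜.A _) (tyRel_monotone φ 𝒜.A _)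
        (tm_related hcar M X γ₁ γ₂ h) (tm_related hcar N X γ₁ γ₂ h)
  | _, _, .fst M, X, γ₁, γ₂, h =>
      KripkeRel.topTop_comp_map (tyRel_monotone φ 𝒜.A _) (tm_related hcar M X γ₁ γ₂ h)
        fun _ _ _ h => h.1
  | _, _, .snd M, X, γ₁, γ₂, h =>
      KripkeRel.topTop_comp_map (tyRel_monotone φ 𝒜.A _) (tm_related hcar M X γ₁ γ₂ h)
        fun _ _ _ h => h.2
  | _, _, .absurd M, X, γ₁, γ₂, h =>
      KripkeRel.topTop_comp_map (tyRel_monotone φ 𝒜.A _) (tm_related hcar M X γ₁ γ₂ h)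
        fun _ _ _ h => h.elim
  | _, _, .inl M, X, γ₁, γ₂, h =>
      KripkeRel.topTop_comp_map (tyRel_monotone φ 𝒜.A (.sum _ _))
        (tm_related hcar M X γ₁ γ₂ h) fun _ a b h => .inl ⟨a, b, h, rfl, rfl⟩
  | _, _, .inr M, X, γ₁, γ₂, h =>
      KripkeRel.topTop_comp_map (tyRel_monotone φ 𝒜.A (.sum _ _))
        (tm_related hcar M X γ₁ γ₂ h) fun _ a b h => .inr ⟨a, b, h, rfl, rfl⟩
  | Γ, _, .case M N₁ N₂, X, γ₁, γ₂, h =>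
      KripkeRel.topTop_comp_case (ctxRel_monotone φ 𝒜.A Γ) h (tm_related hcar M X γ₁ γ₂ h)
        (tm_related hcar N₁) (tm_related hcar N₂)
  | Γ, .arrow ρ τ, .lam M, X, _, _, h =>
      Eq.mp (congrArg₂ ((tyRel φ 𝒜.A (.arrow ρ τ)).topTop φ X) (Category.assoc _ _ _)
          (Category.assoc _ _ _))
        (KripkeRel.topTop_unit (tyRel_monotone φ 𝒜.A (.arrow ρ τ))
          (KripkeRel.exp_cur (ctxRel_monotone φ 𝒜.A Γ) (tm_related hcar M) h))
  | _, _, .app M N, X, γ₁, γ₂, h =>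
      KripkeRel.topTop_comp_extend
        (KripkeRel.topTop_comp_kleisliPair (tyRel_monotone φ 𝒜.A _) (tyRel_monotone φ 𝒜.A _)
          (tm_related hcar M X γ₁ γ₂ h) (tm_related hcar N X γ₁ γ₂ h))
        fun _ _ _ h => KripkeRel.topTop_ev h

end FundamentalLemma
end

end LambdaC

theorem mainTheorem3 {C : Type u} [CategoryTheory.Category.{v} C]
    [CartesianMonoidalCategory C] [MonoidalClosed C] [HasInitial C] [HasBinaryCoproducts C]
    (S : LambdaC.Signature.{w}) (hcar : ∀ c : S.K, (S.car (.inl c)).1.IsProductGround)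
    (T₁ T₂ : LambdaC.StrongMonad C) (φ : LambdaC.StrongMonadHom T₁ T₂)
    (𝒜 : LambdaC.LambdaStructure C S T₁)
    (Γ : LambdaC.Ctx S.B) (ρ : LambdaC.Ty S.B)
    (hΓ : ∀ σ ∈ Γ, σ.IsGround) (hρ : ρ.IsGround) (M : LambdaC.Term S Γ ρ) :
    𝒜.tm M ≫ φ.app (𝒜.ty ρ) =
      eqToHom (LambdaC.interpCtx_eq_of_isGround T₁ T₂ 𝒜.A hΓ) ≫ (𝒜.map φ).tm M ≫
        T₂.map (eqToHom (LambdaC.interpTy_eq_of_isGround T₂ T₁ 𝒜.A hρ)) := by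
  -- The identity environment need not be related to itself when the context contains sums or `0`.
  -- Joint epicness, with trivial parameter `𝟙_ C`, reduces the equation to related environments,
  -- where the fundamental lemma applies.
  refine (cancel_epi (λ_ (𝒜.ctx Γ)).hom).1
    (LambdaC.ctxRel_jointlyEpic φ 𝒜.A hΓ (𝟙_ C) _ _ _ fun Y y γ₁ γ₂ h => ?_)
  have key := LambdaC.KripkeRel.topTop_app
    (eqToHom (LambdaC.interpTy_eq_of_isGround T₂ T₁ 𝒜.A hρ))
    (fun X a b hab => by
      rw [← LambdaC.comp_eqToHom_of_tyRel φ 𝒜.A hρ hab]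
      simp) (LambdaC.tm_related φ 𝒜 hcar M Y γ₁ γ₂ h)
  rw [← LambdaC.comp_eqToHom_of_ctxRel φ 𝒜.A hΓ h] at key
  rw [leftUnitor_hom, lift_snd_assoc, lift_snd_assoc]
  exact (Category.assoc _ _ _).symm.trans
    (key.trans ((Category.assoc _ _ _).trans (Category.assoc _ _ _)))
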